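/- **Proposition 5.3.** A *Feynman diagram* is a finite graph all of whose vertices have degree 1 (the legs) or 3, together with a cyclic ordering of its legs (placed counterclockwise on an oriented circle, the Wilson line) and of the three edges at each trivalent vertex. Let $L$ be a finite-dimensional Lie algebra over a field with a non-degenerate invariant symmetric bilinear form $b$, let $(e_i)$ be a basis of $L$, let $(b^{ij})$ be the inverse of the matrix $(b(e_i,e_j))$, and put $f_{ijk}=b([e_i,e_j],e_k)$. For a Feynman diagram $F$ with $m$ legs, let $T_{L,b}(F)\in L^{\otimes m}$ be the tensor obtained by taking one copy of $\sum b^{ij}e_i\otimes e_j$ for each edge and one copy of $f$ for each trivalent vertex (its three arguments being ordered consistently with the cyclic order of the edges at the vertex), and contracting at all trivalent vertices; the tensor factors, one for each leg, are ordered by cutting the Wilson line at some point. The value $V_L(F)$ of the universal weight system is the image of $T_{L,b}(F)$ in the universal enveloping algebra $U(L)$ under $x_1\otimes\cdots\otimes x_m\mapsto x_1\cdots x_m$. Let $V_{sl}$ be the universal weight system for $L=sl_2(\mathbb C)$ with the form $\langle x,y\rangle=\operatorname{Tr}(xy)$, and let $c=\sum b^{ij}e_ie_j\in U(sl_2)$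 be the quadratic Casimir. Let $w_m$ be the wheel with $m$ spokes, that is, a cycle of $m$ trivalent vertices, each joined by a spoke to one of the $m$ legs, drawn in the plane inside the Wilson line, with counterclockwise cyclic orderings. Then $c$ is transcendental over $\mathbb C$, so that $\mathbb C[c]\subset U(sl_2)$ is a polynomial ring, and for every $n\ge 2$ there is a polynomial $q\in\mathbb C[X]$ of degree less than $n$ such that $$V_{sl}(w_{2n}) = 2^{n+1}c^n + q(c).$$ This holds for every choice of the basis of $sl_2$ and of the point at which the Wilson line is cut. -/

import Mathlib

open scoped TensorProduct Polynomial

/-- A Feynman diagram: a finite graph all of whose vertices have degree 1 (legs) or 3, with a cyclic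
ordering of the legs and of the three edges at every trivalent vertex. The legs are listed along the
Wilson line (in the counterclockwise direction) as `0, 1, …, legs - 1`, followed by `0` again; the
edges at a trivalent vertex `v` occupy the slots `(v, 0), (v, 1), (v, 2)` in counterclockwise order.
An edge `ℓ` has the two endpoints `(ℓ, 0)` and `(ℓ, 1)`, and `attach` says to which leg, or
to which slot of which trivalent vertex, each endpoint of an edge is attached. -/
structure FeynmanDiagram where
  legs : ℕ
  Trivalent : Type
  Edge : Type
  [fintypeTrivalent : Fintype Trivalent]
  [fintypeEdge : Fintype Edge]
  [decEqEdge : DecidableEq Edge]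
  attach : Edge × Fin 2 ≃ Fin legs ⊕ Trivalent × Fin 3

attribute [instance] FeynmanDiagram.fintypeTrivalent FeynmanDiagram.fintypeEdge
  FeynmanDiagram.decEqEdge

namespace FeynmanDiagram

/-- The wheel diagram `w_m`. The rim vertices are numbered `0, …, m - 1` counterclockwise. The
edge `inl i` is the spoke joining leg `i` to the rim vertex `i`; the edge `inr i` is the rim edge
joining the rim vertex `i` to the next one, `finRotate m i` (that is, `i + 1` modulo `m`).
Counterclockwise, the edges at a rim vertex are: the spoke, the rim edge to the next vertex, the
rim edge to the previous vertex. -/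
def wheel (m : ℕ) : FeynmanDiagram where
  legs := m
  Trivalent := Fin m
  Edge := Fin m ⊕ Fin m
  attach :=
    { toFun := fun x => match x with
        | (Sum.inl i, 0) => Sum.inl i
        | (Sum.inl i, 1) => Sum.inr (i, 0)
        | (Sum.inr i, 0) => Sum.inr (i, 1)
        | (Sum.inr i, 1) => Sum.inr (finRotate m i, 2)
      invFun := fun y => match y with
        | Sum.inl i => (Sum.inl i, 0)
        | Sum.inr (i, 0) => (Sum.inl i, 1)
        | Sum.inr (i, 1) => (Sum.inr i, 0)
        | Sum.inr (i, 2) => (Sum.inr ((finRotate m).symm i), 1)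
      left_inv := by
        rintro ⟨i | i, j⟩ <;> fin_cases j <;> simp [-finRotate_apply]
      right_inv := by
        rintro (i | ⟨i, j⟩)
        · rfl
        · fin_cases j
          · rfl
          · rfl
          · exact congrArg (fun a => Sum.inr (a, 2)) ((finRotate m).apply_symm_apply i) }

section LieAlgebraWeights

attribute [local instance] LieRing.ofAssociativeRing

variable {k L ι : Type*} [Field k] [LieRing L] [LieAlgebra k L] [Fintype ι] [DecidableEq ι]

/-- The components `b^{ij}` in the basis `e` of the symmetric tensor in `L ⊗ L` given by the inner
product `b`: the matrix inverse to `b_{ij} = b(e_i, e_j)`. -/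
noncomputable def metricInv (b : LinearMap.BilinForm k L) (e : Module.Basis ι k L) :
    Matrix ι ι k :=
  (Matrix.of fun i j => b (e i) (e j))⁻¹

/-- The components `f_{ijl} = b([e_i, e_j], e_l)` of the bracket, viewed as a tensor in `(L*)^{⊗3}`
by means of `b`. -/
noncomputable def bracketTensor (b : LinearMap.BilinForm k L) (e : Module.Basis ι k L) (i j l : ι) : k :=
  b ⁅e i, e j⁆ (e l)

/-- The tensor `T_{L,b}(F)` in `L^{⊗ legs}`: one copy of `b^{ij}` for every edge, one copy of
`f_{ijl}` for every trivalent vertex, contracted at all trivalent vertices; a basis index `σ x` is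
attached to every endpoint `x` of an edge. The Wilson line is cut just before the leg number `s`
(modulo the number of legs), so the legs are taken in the order `s, s + 1, …`. -/
noncomputable def tensor (b : LinearMap.BilinForm k L) (e : Module.Basis ι k L)
    (F : FeynmanDiagram) (s : ℕ) : ⨂[k] (_ : Fin F.legs), L :=
  ∑ σ : F.Edge × Fin 2 → ι,
    ((∏ ℓ : F.Edge, metricInv b e (σ (ℓ, 0)) (σ (ℓ, 1))) *
      ∏ v : F.Trivalent, bracketTensor b e
        (σ (F.attach.symm (Sum.inr (v, 0))))
        (σ (F.attach.symm (Sum.inr (v, 1))))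
        (σ (F.attach.symm (Sum.inr (v, 2))))) •
    PiTensorProduct.tprod k fun j : Fin F.legs =>
      e (σ (F.attach.symm (Sum.inl (((finRotate F.legs) ^ s) j))))

/-- The natural map `L^{⊗m} → U(L)`, `x_1 ⊗ ⋯ ⊗ x_m ↦ x_1 ⋯ x_m`. -/
noncomputable def toEnveloping (k L : Type*) [Field k] [LieRing L] [LieAlgebra k L] (m : ℕ) :
    (⨂[k] (_ : Fin m), L) →ₗ[k] UniversalEnvelopingAlgebra k L :=
  PiTensorProduct.lift
    ((MultilinearMap.mkPiAlgebraFin k m (UniversalEnvelopingAlgebra k L)).compLinearMap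
      fun _ => LieHom.toLinearMap (UniversalEnvelopingAlgebra.ι k))

/-- The value `V_{L,b}(F)` of the universal weight system: the image of `T_{L,b}(F)` in `U(L)`,
computed in the basis `e` and with the Wilson line cut before the leg number `s`. -/
noncomputable def universalWeight (b : LinearMap.BilinForm k L) (e : Module.Basis ι k L)
    (F : FeynmanDiagram) (s : ℕ) : UniversalEnvelopingAlgebra k L :=
  toEnveloping k L F.legs (tensor b e F s)

/-- The quadratic Casimir element `∑ b^{ij} e_i e_j` in `U(L)`. -/
noncomputable def casimir (b : LinearMap.BilinForm k L) (e : Module.Basis ι k L) :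
    UniversalEnvelopingAlgebra k L :=
  ∑ i, ∑ j, metricInv b e i j •
    (UniversalEnvelopingAlgebra.ι k (e i) * UniversalEnvelopingAlgebra.ι k (e j))

end LieAlgebraWeights

/-- The Lie algebra `sl_2` over the complex numbers (traceless 2 × 2 matrices). -/
abbrev SL2 : Type := LieAlgebra.SpecialLinear.sl (Fin 2) ℂ

/-- The standard invariant form `⟨x, y⟩ = Tr(xy)` on `sl_2`. -/
def slForm : LinearMap.BilinForm ℂ SL2 :=
  LinearMap.mk₂ ℂ
    (fun x y => Matrix.trace ((x : Matrix (Fin 2) (Fin 2) ℂ) * (y : Matrix (Fin 2) (Fin 2) ℂ)))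
    (fun x y z => by simp [add_mul])
    (fun a x y => by simp)
    (fun x y z => by simp [mul_add])
    (fun a x y => by simp)

end FeynmanDiagram

/-! A wheel is a closed chain of identical pieces (vertex, spoke, next rim edge), so its weight is
the trace of a power of one matrix M over U(L), the `spokeMatrix` (`universalWeight_wheel`). A
change of basis conjugates M by a scalar matrix, so the standard basis of sl_2 suffices.

There M is the split Casimir acting through the adjoint representation. On V_λ ⊗ V_2 its eigenvalues
on the summands V_(λ+2), V_λ, V_(λ-2) are λ, -2, -λ-2, where c acts as λ²/2 + λ; this explains the
cubic (M + 2)(M² + 2M - 2c) = 0, verified directly in `Matrix.sl2_cubic`. Hence t_m = tr M^m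
satisfies t_(m+3) = -4 t_(m+2) + (2c - 4) t_(m+1) + 4c t_m with t_0 = 3, t_1 = 0, t_2 = 4c. By
induction t_(2n) has leading term 2^(n+1) c^n and t_(2n+1) has degree at most n
(`recursion_leading_term`).

Transcendence of c holds because every complex number is an eigenvalue of c in some representation.
-/

/-! ### Matrix powers as sums over paths, with noncommuting entries -/

/-- `q` lists the interior points of a path from `i` to `j`; `List.prod` keeps the factors in path
order. -/
theorem Matrix.sum_prod_ofFn_cons_snoc {ι R : Type*} [Fintype ι] [DecidableEq ι] [Semiring R]
    (M : Matrix ι ι R) (m : ℕ) (i j : ι) :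
    ∑ q : Fin m → ι, (List.ofFn fun t : Fin (m + 1) =>
      M ((Fin.cons i q : Fin (m + 1) → ι) t) ((Fin.snoc q j : Fin (m + 1) → ι) t)).prod =
      (M ^ (m + 1)) i j := by
  induction m generalizing i with
  | zero => simp [Fin.snoc]
  | succ m ih =>
    rw [pow_succ', Matrix.mul_apply, ← (Fin.consEquiv fun _ => ι).sum_comp, Fintype.sum_prod_type]
    refine Finset.sum_congr rfl fun r _ => ?_
    rw [← ih, Finset.mul_sum]
    refine Finset.sum_congr rfl fun q _ => ?_
    rw [List.ofFn_succ, List.prod_cons]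
    simp [Fin.consEquiv, ← Fin.cons_snoc_eq_snoc_cons]

theorem Matrix.sum_prod_ofFn_finRotate {ι R : Type*} [Fintype ι] [DecidableEq ι] [Semiring R]
    (M : Matrix ι ι R) (m : ℕ) :
    ∑ q : Fin (m + 1) → ι, (List.ofFn fun t => M (q t) (q (finRotate (m + 1) t))).prod =
      (M ^ (m + 1)).trace := by
  rw [← (Fin.consEquiv fun _ => ι).sum_comp, Fintype.sum_prod_type, Matrix.trace]
  refine Finset.sum_congr rfl fun r _ => ?_
  rw [Matrix.diag_apply, ← Matrix.sum_prod_ofFn_cons_snoc]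
  refine Finset.sum_congr rfl fun q _ => ?_
  -- For a path closing up at its starting point, the list of endpoints of the steps is the rotated
  -- list of their starting points.
  simp only [Fin.snoc_eq_cons_rotate]
  rfl

/-! ### The weight of a wheel as a trace -/

namespace FeynmanDiagram

section
attribute [local instance] LieRing.ofAssociativeRing

variable {k L ι : Type*} [Field k] [LieRing L] [LieAlgebra k L] [Fintype ι] [DecidableEq ι]

/-- The matrix over `U(L)` read off at one vertex of a wheel, with its spoke and the rim edge
to the next vertex. -/
noncomputable def spokeMatrix (b : LinearMap.BilinForm k L) (e : Module.Basis ι k L) :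
    Matrix ι ι (UniversalEnvelopingAlgebra k L) :=
  Matrix.of fun q r => ∑ x : ι × ι × ι,
    (metricInv b e x.1 x.2.1 * metricInv b e x.2.2 r * bracketTensor b e x.2.1 x.2.2 q) •
      UniversalEnvelopingAlgebra.ι k (e x.1)

/-- A colouring of the edge endpoints of a wheel amounts to three colours at every vertex (the two
ends of the spoke, and the start of the next rim edge) and one more for the end of
the previous rim edge, where the vertices are renumbered by `ρ`. -/
def wheelColoringEquiv (ι : Type*) (m : ℕ) (ρ : Equiv.Perm (Fin m)) :
    ((Fin m ⊕ Fin m) × Fin 2 → ι) ≃ (Fin m → ι) × (Fin m → ι × ι × ι) where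
  toFun σ := (fun j => σ (Sum.inr ((finRotate m).symm (ρ j)), 1),
    fun j => (σ (Sum.inl (ρ j), 0), σ (Sum.inl (ρ j), 1), σ (Sum.inr (ρ j), 0)))
  invFun g := fun x => match x with
    | (Sum.inl i, 0) => (g.2 (ρ.symm i)).1
    | (Sum.inl i, 1) => (g.2 (ρ.symm i)).2.1
    | (Sum.inr i, 0) => (g.2 (ρ.symm i)).2.2
    | (Sum.inr i, 1) => g.1 (ρ.symm (finRotate m i))
  left_inv σ := by
    ext ⟨i | i, j⟩ <;> fin_cases j <;> simp [-finRotate_apply]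
  right_inv g := by
    refine Prod.ext (funext fun j => ?_) (funext fun j => ?_)
    · change g.1 (ρ.symm (finRotate m ((finRotate m).symm (ρ j)))) = g.1 j
      rw [Equiv.apply_symm_apply, Equiv.symm_apply_apply]
    · change g.2 (ρ.symm (ρ j)) = g.2 j
      rw [Equiv.symm_apply_apply]

/-- Expanding the trace gives one summand for each colouring of the edge ends, with the legs
multiplied in order from the cut. The cut `s` only renumbers the vertices by a rotation. The
exponent must be positive: the empty wheel has weight 1, whereas the zeroth power has trace
`Fintype.card ι`. -/
theorem universalWeight_wheel (b : LinearMap.BilinForm k L) (e : Module.Basis ι k L) (m s : ℕ) :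
    universalWeight b e (wheel (m + 1)) s = (spokeMatrix b e ^ (m + 1)).trace := by
  rw [← Matrix.sum_prod_ofFn_finRotate]
  have key : ∀ q : Fin (m + 1) → ι,
      (List.ofFn fun t => spokeMatrix b e (q t) (q (finRotate (m + 1) t))).prod =
      ∑ g : Fin (m + 1) → ι × ι × ι, (∏ t, (metricInv b e (g t).1 (g t).2.1 *
        metricInv b e (g t).2.2 (q (finRotate (m + 1) t)) *
        bracketTensor b e (g t).2.1 (g t).2.2 (q t))) •
        (List.ofFn fun t => UniversalEnvelopingAlgebra.ι k (e (g t).1)).prod := by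
    intro q
    simp only [← MultilinearMap.mkPiAlgebraFin_apply (R := k), ← MultilinearMap.map_smul_univ]
    simp only [spokeMatrix, Matrix.of_apply]
    rw [MultilinearMap.map_sum]
  simp only [key]
  rw [← Fintype.sum_prod_type', universalWeight, tensor, map_sum]
  set ρ : Equiv.Perm (Fin (m + 1)) := finRotate (m + 1) ^ s with hρ
  -- The renumbering is a power of the rotation, so it commutes with passing to the next vertex.
  have hcomm : ∀ j, (finRotate (m + 1)).symm (ρ (finRotate (m + 1) j)) = ρ j := by
    intro j
    rw [Equiv.symm_apply_eq, ← Equiv.Perm.mul_apply, ← Equiv.Perm.mul_apply, hρ, ← pow_succ,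
      ← pow_succ']
  refine Fintype.sum_equiv (wheelColoringEquiv ι (m + 1) ρ) _ _ fun σ => ?_
  rw [map_smul]
  congr 1
  · simp only [wheelColoringEquiv, Equiv.coe_fn_mk, hcomm]
    rw [Equiv.prod_comp ρ fun i => metricInv b e (σ (Sum.inl i, 0)) (σ (Sum.inl i, 1)) *
      metricInv b e (σ (Sum.inr i, 0)) (σ (Sum.inr i, 1)) * bracketTensor b e
        (σ (Sum.inl i, 1)) (σ (Sum.inr i, 0)) (σ (Sum.inr ((finRotate (m + 1)).symm i), 1))]
    rw [Finset.prod_mul_distrib, Finset.prod_mul_distrib]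
    congr 1
    exact Fintype.prod_sum_type _
  · simp only [toEnveloping, PiTensorProduct.lift.tprod, MultilinearMap.compLinearMap_apply]
    exact MultilinearMap.mkPiAlgebraFin_apply _
end
end FeynmanDiagram

/-! ### Independence of the basis -/

namespace FeynmanDiagram
section
attribute [local instance] LieRing.ofAssociativeRing

variable {k L ι κ : Type*} [Field k] [LieRing L] [LieAlgebra k L] [Fintype ι] [DecidableEq ι]
  [Fintype κ] [DecidableEq κ]

theorem metricInv_eq (b : LinearMap.BilinForm k L) (e : Module.Basis ι k L) :
    metricInv b e = (LinearMap.BilinForm.toMatrix e b)⁻¹ := by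
  rw [metricInv]
  congr 1
  ext i j
  simp [LinearMap.BilinForm.toMatrix_apply]

theorem sum_metricInv_smul {b : LinearMap.BilinForm k L} (hb : b.Nondegenerate)
    (e : Module.Basis ι k L) (z : L) :
    ∑ i, ∑ j, (metricInv b e i j * b (e j) z) • e i = z := by
  have hdet : IsUnit (LinearMap.BilinForm.toMatrix e b).det :=
    ((LinearMap.BilinForm.nondegenerate_iff_det_ne_zero e).1 hb).isUnit
  have hz : ∀ j, b (e j) z = ((LinearMap.BilinForm.toMatrix e b).mulVec (e.repr z)) j := by
    intro j
    conv_lhs => rw [← e.sum_repr z, map_sum]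
    simp [-Module.Basis.sum_repr, Matrix.mulVec, dotProduct, LinearMap.BilinForm.toMatrix_apply, mul_comm]
  have hsum : ∀ i, ∑ j, metricInv b e i j * b (e j) z = e.repr z i := by
    intro i
    simp only [hz, metricInv_eq]
    change ((LinearMap.BilinForm.toMatrix e b)⁻¹.mulVec
      ((LinearMap.BilinForm.toMatrix e b).mulVec (e.repr z))) i = _
    rw [Matrix.mulVec_mulVec, Matrix.nonsing_inv_mul _ hdet, Matrix.one_mulVec]
  simp only [← Finset.sum_smul, hsum, e.sum_repr]

/-- The brackets of the basis vectors, as a matrix over `U(L)`. -/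
noncomputable def lieMatrix (e : Module.Basis ι k L) :
    Matrix ι ι (UniversalEnvelopingAlgebra k L) :=
  Matrix.of fun i j => UniversalEnvelopingAlgebra.ι k ⁅e i, e j⁆

/-- By invariance, f_{jpq} = b(e_j, [e_p, e_q]), so contracting it with the spoke's b^{ij} recovers
[e_p, e_q]. The rim edge contributes the remaining b^{pr}, and the sign comes from swapping p and q.
-/
theorem spokeMatrix_eq {b : LinearMap.BilinForm k L} (hb : b.Nondegenerate)
    (hinv : ∀ x y z, b ⁅x, y⁆ z = b x ⁅y, z⁆) (e : Module.Basis ι k L) :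
    spokeMatrix b e = -(lieMatrix e * (metricInv b e).map (algebraMap k (UniversalEnvelopingAlgebra k L))) := by
  ext q r
  have hp : ∀ p, UniversalEnvelopingAlgebra.ι k ⁅e p, e q⁆ = ∑ i, ∑ j,
      (metricInv b e i j * bracketTensor b e j p q) • UniversalEnvelopingAlgebra.ι k (e i) := by
    intro p
    conv_lhs => rw [← sum_metricInv_smul hb e ⁅e p, e q⁆]
    simp [bracketTensor, hinv]
  rw [Matrix.neg_apply, Matrix.mul_apply, ← Finset.sum_neg_distrib]
  have hterm : ∀ p, -(lieMatrix e q p * (metricInv b e).map (algebraMap k (UniversalEnvelopingAlgebra k L)) p r) =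
      ∑ i, ∑ j, (metricInv b e i j * metricInv b e p r * bracketTensor b e j p q) •
        UniversalEnvelopingAlgebra.ι k (e i) := by
    intro p
    rw [Matrix.map_apply, ← Algebra.commutes, ← Algebra.smul_def, lieMatrix, Matrix.of_apply,
      ← lie_skew, map_neg, smul_neg, neg_neg, hp, Finset.smul_sum]
    refine Finset.sum_congr rfl fun i _ => ?_
    rw [Finset.smul_sum]
    refine Finset.sum_congr rfl fun j _ => ?_
    rw [smul_smul]
    congr 1
    ring
  simp only [hterm, spokeMatrix, Matrix.of_apply, Fintype.sum_prod_type]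
  conv_rhs => rw [Finset.sum_comm]
  refine Finset.sum_congr rfl fun i _ => ?_
  rw [Finset.sum_comm]

theorem metricInv_basis_change {b : LinearMap.BilinForm k L} (hb : b.Nondegenerate)
    (e : Module.Basis ι k L) (h : Module.Basis κ k L) :
    metricInv b e = e.toMatrix h * metricInv b h * (e.toMatrix h).transpose := by
  have hdet : IsUnit (LinearMap.BilinForm.toMatrix h b).det :=
    ((LinearMap.BilinForm.nondegenerate_iff_det_ne_zero h).1 hb).isUnit
  rw [metricInv_eq, metricInv_eq]
  apply Matrix.inv_eq_right_inv
  rw [← LinearMap.BilinForm.toMatrix_mul_basis_toMatrix h e b]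
  have h1 : h.toMatrix e * e.toMatrix h = 1 := h.toMatrix_mul_toMatrix_flip e
  have h2 : (h.toMatrix e).transpose * (e.toMatrix h).transpose = 1 := by
    rw [← Matrix.transpose_mul, e.toMatrix_mul_toMatrix_flip h, Matrix.transpose_one]
  calc _ = (h.toMatrix e).transpose * (LinearMap.BilinForm.toMatrix h b *
        ((h.toMatrix e * e.toMatrix h) * (LinearMap.BilinForm.toMatrix h b)⁻¹)) *
          (e.toMatrix h).transpose := by simp only [Matrix.mul_assoc]
    _ = 1 := by rw [h1, Matrix.one_mul, Matrix.mul_nonsing_inv _ hdet, Matrix.mul_one, h2]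

omit [Fintype ι] [DecidableEq ι] [DecidableEq κ] in
theorem lieMatrix_basis_change (e : Module.Basis ι k L) (h : Module.Basis κ k L) :
    lieMatrix e = ((h.toMatrix e).transpose.map (algebraMap k (UniversalEnvelopingAlgebra k L))) * lieMatrix h *
      (h.toMatrix e).map (algebraMap k (UniversalEnvelopingAlgebra k L)) := by
  ext i j
  have he : ∀ i, e i = ∑ l, h.toMatrix e l i • h l := fun i => (h.sum_toMatrix_smul_self e i).symm
  have hr : ∀ (r : k) (x : UniversalEnvelopingAlgebra k L), x * algebraMap k _ r = r • x :=
    fun r x => by rw [← Algebra.commutes, Algebra.smul_def]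
  rw [lieMatrix, Matrix.of_apply, he i, he j]
  simp only [lieMatrix, Matrix.mul_apply, Matrix.of_apply, Matrix.map_apply,
    Matrix.transpose_apply, lie_sum, sum_lie, lie_smul, smul_lie, map_sum, map_smul,
    ← Algebra.smul_def, hr, Finset.smul_sum]

omit [DecidableEq ι] [Fintype κ] in
theorem map_toMatrix_mul_flip (A : Type*) [Ring A] [Algebra k A]
    (e : Module.Basis ι k L) (h : Module.Basis κ k L) :
    (h.toMatrix e).map (algebraMap k A) * (e.toMatrix h).map (algebraMap k A) = 1 := by
  rw [← Matrix.map_mul, h.toMatrix_mul_toMatrix_flip e]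
  simp

omit [DecidableEq ι] [Fintype κ] in
theorem map_toMatrix_transpose_mul_flip (A : Type*) [Ring A] [Algebra k A]
    (e : Module.Basis ι k L) (h : Module.Basis κ k L) :
    (e.toMatrix h).transpose.map (algebraMap k A) * (h.toMatrix e).transpose.map (algebraMap k A)
      = 1 := by
  rw [← Matrix.map_mul, ← Matrix.transpose_mul, h.toMatrix_mul_toMatrix_flip e]
  simp

/-- The bracket matrix is covariant and the inverse metric contravariant, so their inner transition
matrices cancel and a conjugation remains. -/
theorem spokeMatrix_basis_change {b : LinearMap.BilinForm k L} (hb : b.Nondegenerate)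
    (hinv : ∀ x y z, b ⁅x, y⁆ z = b x ⁅y, z⁆)
    (e : Module.Basis ι k L) (h : Module.Basis κ k L) :
    spokeMatrix b e = (h.toMatrix e).transpose.map (algebraMap k (UniversalEnvelopingAlgebra k L)) * spokeMatrix b h *
      (e.toMatrix h).transpose.map (algebraMap k (UniversalEnvelopingAlgebra k L)) := by
  rw [spokeMatrix_eq hb hinv, spokeMatrix_eq hb hinv, lieMatrix_basis_change e h,
    metricInv_basis_change hb e h, Matrix.map_mul, Matrix.map_mul]
  have h1 := map_toMatrix_mul_flip (UniversalEnvelopingAlgebra k L) e h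
  rw [Matrix.mul_neg, Matrix.neg_mul]
  congr 1
  simp only [Matrix.mul_assoc]
  rw [← Matrix.mul_assoc ((h.toMatrix e).map _), h1, Matrix.one_mul]

theorem trace_spokeMatrix_pow_basis_change {b : LinearMap.BilinForm k L} (hb : b.Nondegenerate)
    (hinv : ∀ x y z, b ⁅x, y⁆ z = b x ⁅y, z⁆)
    (e : Module.Basis ι k L) (h : Module.Basis κ k L) (m : ℕ) :
    (spokeMatrix b e ^ m).trace = (spokeMatrix b h ^ m).trace := by
  have h1 := map_toMatrix_transpose_mul_flip (UniversalEnvelopingAlgebra k L) e h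
  have h2 := map_toMatrix_transpose_mul_flip (UniversalEnvelopingAlgebra k L) h e
  have hpow : spokeMatrix b e ^ m = (h.toMatrix e).transpose.map (algebraMap k (UniversalEnvelopingAlgebra k L)) *
      spokeMatrix b h ^ m * (e.toMatrix h).transpose.map (algebraMap k (UniversalEnvelopingAlgebra k L)) := by
    induction m with
    | zero => rw [pow_zero, pow_zero, Matrix.mul_one, h2]
    | succ m ih =>
      rw [pow_succ, ih, spokeMatrix_basis_change hb hinv e h, pow_succ]
      simp only [Matrix.mul_assoc]
      rw [← Matrix.mul_assoc ((e.toMatrix h).transpose.map _), h1, Matrix.one_mul]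
  -- The trace is not cyclic over a noncommutative ring, but a factor with scalar, hence central,
  -- entries may be moved around.
  have hcomm : ∀ (X : Matrix κ ι (UniversalEnvelopingAlgebra k L)) (P : Matrix ι κ k),
      (P.map (algebraMap k (UniversalEnvelopingAlgebra k L)) * X).trace = (X * P.map (algebraMap k (UniversalEnvelopingAlgebra k L))).trace := by
    intro X P
    simp only [Matrix.trace, Matrix.diag_apply, Matrix.mul_apply, Matrix.map_apply]
    rw [Finset.sum_comm]
    simp only [Algebra.commutes]
  rw [hpow, Matrix.mul_assoc, hcomm, Matrix.mul_assoc, h1, Matrix.mul_one]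

/-- In the form row · matrix · column, transition matrices cancel by matrix algebra. -/
theorem casimir_eq_mul_apply (b : LinearMap.BilinForm k L) (e : Module.Basis ι k L) :
    casimir b e = (Matrix.of (fun (_ : Unit) i => UniversalEnvelopingAlgebra.ι k (e i)) *
      (metricInv b e).map (algebraMap k (UniversalEnvelopingAlgebra k L)) *
      Matrix.of (fun i (_ : Unit) => UniversalEnvelopingAlgebra.ι k (e i))) () () := by
  simp only [casimir, Matrix.mul_apply, Matrix.of_apply, Matrix.map_apply, Finset.sum_mul]
  rw [Finset.sum_comm]
  simp only [← Algebra.commutes (_ : k) (_ : UniversalEnvelopingAlgebra k L),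
    ← Algebra.smul_def, smul_mul_assoc]

theorem casimir_basis_change {b : LinearMap.BilinForm k L} (hb : b.Nondegenerate)
    (e : Module.Basis ι k L) (h : Module.Basis κ k L) : casimir b e = casimir b h := by
  have he : ∀ i, e i = ∑ l, h.toMatrix e l i • h l := fun i => (h.sum_toMatrix_smul_self e i).symm
  have hrow : Matrix.of (fun (_ : Unit) i => UniversalEnvelopingAlgebra.ι k (e i)) =
      Matrix.of (fun (_ : Unit) i => UniversalEnvelopingAlgebra.ι k (h i)) *
        (h.toMatrix e).map (algebraMap k (UniversalEnvelopingAlgebra k L)) := by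
    ext _ i
    simp only [Matrix.mul_apply, Matrix.of_apply, Matrix.map_apply]
    rw [he i]
    simp only [map_sum, map_smul, ← Algebra.commutes (_ : k) (_ : UniversalEnvelopingAlgebra k L),
      ← Algebra.smul_def]
  have hcol : Matrix.of (fun i (_ : Unit) => UniversalEnvelopingAlgebra.ι k (e i)) =
      (h.toMatrix e).transpose.map (algebraMap k (UniversalEnvelopingAlgebra k L)) *
      Matrix.of (fun i (_ : Unit) => UniversalEnvelopingAlgebra.ι k (h i)) := by
    ext i _
    simp only [Matrix.mul_apply, Matrix.of_apply, Matrix.map_apply, Matrix.transpose_apply]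
    rw [he i]
    simp only [map_sum, map_smul, ← Algebra.smul_def]
  rw [casimir_eq_mul_apply, casimir_eq_mul_apply, hrow, hcol, metricInv_basis_change hb e h, Matrix.map_mul, Matrix.map_mul]
  simp only [Matrix.mul_assoc]
  rw [← Matrix.mul_assoc ((h.toMatrix e).map _), map_toMatrix_mul_flip, Matrix.one_mul,
    ← Matrix.mul_assoc ((e.toMatrix h).transpose.map _), map_toMatrix_transpose_mul_flip,
    Matrix.one_mul]
end
end FeynmanDiagram

/-! ### The cubic identity -/

/-- The split Casimir element of `sl_2`, acting by the adjoint representation on one factor, satisfies the cubic characteristic identity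
`(M + 2) (M ^ 2 + 2 M - 2 c) = 0`. -/
theorem Matrix.sl2_cubic {R : Type*} [Ring R] {E F H : R} (hHE : H * E = E * H + 2 * E)
    (hHF : H * F = F * H - 2 * F) (hFE : F * E = E * F - H) (c : R)
    (hc : 2 * c = 2 * (E * F + F * E) + H * H) :
    (!![-H, 0, E; 0, H, -F; 2 * F, -2 * E, 0] : Matrix (Fin 3) (Fin 3) R) ^ 3 =
      (-4 : R) • !![-H, 0, E; 0, H, -F; 2 * F, -2 * E, 0] ^ 2 +
      (2 * c - 4) • !![-H, 0, E; 0, H, -F; 2 * F, -2 * E, 0] + (2 * (2 * c)) • 1 := by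
  -- With these variants for right-associated products, every monomial is rewritten in the order E,
  -- F, H, where both sides agree.
  have aHE : ∀ x, H * (E * x) = E * (H * x) + 2 * (E * x) := fun x => by
    rw [← mul_assoc, hHE]; noncomm_ring
  have aHF : ∀ x, H * (F * x) = F * (H * x) - 2 * (F * x) := fun x => by
    rw [← mul_assoc, hHF]; noncomm_ring
  have aFE : ∀ x, F * (E * x) = E * (F * x) - H * x := fun x => by
    rw [← mul_assoc, hFE]; noncomm_ring
  rw [hc, pow_succ, pow_two]
  ext i j
  fin_cases i <;> fin_cases j <;>
  simp [Matrix.mul_apply, Fin.sum_univ_three] <;> noncomm_ring <;>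
  simp only [hHE, hHF, hFE, aHE, aHF, aFE, mul_add, mul_sub] <;> noncomm_ring <;>
  simp only [hHE, hHF, hFE] <;> noncomm_ring

/-! ### Explicit computations in the standard basis of sl_2 -/

namespace FeynmanDiagram

/-- The coordinates `(x₀₁, x₁₀, x₀₀)` on `sl_2`. -/
def sl2Coord : SL2 ≃ₗ[ℂ] (Fin 3 → ℂ) where
  toFun x := ![x.1 0 1, x.1 1 0, x.1 0 0]
  map_add' x y := by ext i; fin_cases i <;> simp
  map_smul' a x := by ext i; fin_cases i <;> simp
  invFun v := ⟨!![v 2, v 0; v 1, -v 2], by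
    change Matrix.trace !![v 2, v 0; v 1, -v 2] = 0
    simp [Matrix.trace_fin_two]⟩
  left_inv x := by
    have hx : Matrix.trace x.1 = 0 := x.2
    rw [Matrix.trace_fin_two] at hx
    ext i j
    fin_cases i <;> fin_cases j <;> simp
    exact (eq_neg_of_add_eq_zero_right hx).symm
  right_inv v := by ext i; fin_cases i <;> simp

/-- The standard basis `E, F, H` of `sl_2`. -/
noncomputable def sl2Basis : Module.Basis (Fin 3) ℂ SL2 := Module.Basis.ofEquivFun sl2Coord

theorem sl2Basis_zero : (sl2Basis 0 : Matrix (Fin 2) (Fin 2) ℂ) = !![0, 1; 0, 0] := by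
  simp [sl2Basis, sl2Coord]

theorem sl2Basis_one : (sl2Basis 1 : Matrix (Fin 2) (Fin 2) ℂ) = !![0, 0; 1, 0] := by
  simp [sl2Basis, sl2Coord]

theorem sl2Basis_two : (sl2Basis 2 : Matrix (Fin 2) (Fin 2) ℂ) = !![1, 0; 0, -1] := by
  simp [sl2Basis, sl2Coord]

theorem slForm_apply (x y : SL2) : slForm x y = Matrix.trace (x.1 * y.1) := rfl

theorem slForm_lie (x y z : SL2) : slForm ⁅x, y⁆ z = slForm x ⁅y, z⁆ := by
  rw [slForm_apply, slForm_apply, LieAlgebra.SpecialLinear.sl_bracket,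
    LieAlgebra.SpecialLinear.sl_bracket, sub_mul, mul_sub, Matrix.trace_sub, Matrix.trace_sub,
    Matrix.mul_assoc, Matrix.mul_assoc, Matrix.trace_mul_comm y.1, Matrix.mul_assoc]

theorem toMatrix_slForm :
    LinearMap.BilinForm.toMatrix sl2Basis slForm = !![0, 1, 0; 1, 0, 0; 0, 0, 2] := by
  ext i j
  rw [LinearMap.BilinForm.toMatrix_apply, slForm_apply]
  fin_cases i <;> fin_cases j <;>
    simp [sl2Basis_zero, sl2Basis_one, sl2Basis_two, Matrix.trace_fin_two, one_add_one_eq_two]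

theorem slForm_nondegenerate : slForm.Nondegenerate := by
  rw [LinearMap.BilinForm.nondegenerate_iff_det_ne_zero sl2Basis, toMatrix_slForm]
  simp [Matrix.det_fin_three]

theorem metricInv_sl2Basis :
    metricInv slForm sl2Basis = !![0, 1, 0; 1, 0, 0; 0, 0, 2⁻¹] := by
  rw [metricInv_eq, toMatrix_slForm]
  apply Matrix.inv_eq_right_inv
  ext i j
  fin_cases i <;> fin_cases j <;> simp [Matrix.mul_apply, Fin.sum_univ_three]

theorem lie_two_zero : ⁅sl2Basis 2, sl2Basis 0⁆ = (2 : ℂ) • sl2Basis 0 := by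
  ext i j
  fin_cases i <;> fin_cases j <;>
    simp [-LieSubalgebra.coe_bracket, LieAlgebra.SpecialLinear.sl_bracket, sl2Basis_zero,
      sl2Basis_two, one_add_one_eq_two]

theorem lie_two_one : ⁅sl2Basis 2, sl2Basis 1⁆ = (-2 : ℂ) • sl2Basis 1 := by
  ext i j
  fin_cases i <;> fin_cases j <;>
    simp [-LieSubalgebra.coe_bracket, LieAlgebra.SpecialLinear.sl_bracket, sl2Basis_one, sl2Basis_two]
  norm_num

theorem lie_zero_one : ⁅sl2Basis 0, sl2Basis 1⁆ = sl2Basis 2 := by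
  ext i j
  fin_cases i <;> fin_cases j <;>
    simp [-LieSubalgebra.coe_bracket, LieAlgebra.SpecialLinear.sl_bracket, sl2Basis_zero,
      sl2Basis_one, sl2Basis_two]

section
attribute [local instance] LieRing.ofAssociativeRing

/-- The images of the standard basis of `sl_2` in the universal enveloping algebra. -/
noncomputable def sl2Gen (i : Fin 3) : UniversalEnvelopingAlgebra ℂ SL2 :=
  UniversalEnvelopingAlgebra.ι ℂ (sl2Basis i)

theorem sl2Gen_two_mul_zero : sl2Gen 2 * sl2Gen 0 = sl2Gen 0 * sl2Gen 2 + 2 * sl2Gen 0 := by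
  have h := congrArg (UniversalEnvelopingAlgebra.ι ℂ) lie_two_zero
  rw [LieHom.map_lie, map_smul, LieRing.of_associative_ring_bracket, ofNat_smul_eq_nsmul,
    nsmul_eq_mul] at h
  exact sub_eq_iff_eq_add'.1 h

theorem sl2Gen_two_mul_one : sl2Gen 2 * sl2Gen 1 = sl2Gen 1 * sl2Gen 2 - 2 * sl2Gen 1 := by
  have h := congrArg (UniversalEnvelopingAlgebra.ι ℂ) lie_two_one
  rw [LieHom.map_lie, map_smul, LieRing.of_associative_ring_bracket, neg_smul, ofNat_smul_eq_nsmul,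
    nsmul_eq_mul] at h
  rw [sub_eq_add_neg]
  exact sub_eq_iff_eq_add'.1 h

theorem sl2Gen_one_mul_zero : sl2Gen 1 * sl2Gen 0 = sl2Gen 0 * sl2Gen 1 - sl2Gen 2 := by
  have h := congrArg (UniversalEnvelopingAlgebra.ι ℂ) lie_zero_one
  rw [LieHom.map_lie, LieRing.of_associative_ring_bracket] at h
  exact (sub_eq_iff_eq_add.2 (sub_eq_iff_eq_add'.1 h)).symm

theorem casimir_sl2Basis : casimir slForm sl2Basis =
    sl2Gen 0 * sl2Gen 1 + sl2Gen 1 * sl2Gen 0 + (2⁻¹ : ℂ) • (sl2Gen 2 * sl2Gen 2) := by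
  simp [casimir, metricInv_sl2Basis, Fin.sum_univ_three, sl2Gen]

theorem two_mul_casimir_sl2Basis : 2 * casimir slForm sl2Basis =
    2 * (sl2Gen 0 * sl2Gen 1 + sl2Gen 1 * sl2Gen 0) + sl2Gen 2 * sl2Gen 2 := by
  rw [casimir_sl2Basis, mul_add]
  congr 1
  rw [two_mul, ← add_smul]
  norm_num

theorem spokeMatrix_sl2Basis : spokeMatrix slForm sl2Basis =
    !![-sl2Gen 2, 0, sl2Gen 0; 0, sl2Gen 2, -sl2Gen 1; 2 * sl2Gen 1, -2 * sl2Gen 0, 0] := by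
  rw [spokeMatrix_eq slForm_nondegenerate slForm_lie, metricInv_sl2Basis]
  have h01 := lie_zero_one
  have h10 : ⁅sl2Basis 1, sl2Basis 0⁆ = -sl2Basis 2 := by rw [← lie_skew, h01]
  have h02 : ⁅sl2Basis 0, sl2Basis 2⁆ = -((2 : ℂ) • sl2Basis 0) := by
    rw [← lie_skew, lie_two_zero]
  have h12 : ⁅sl2Basis 1, sl2Basis 2⁆ = (2 : ℂ) • sl2Basis 1 := by
    rw [← lie_skew, lie_two_one, neg_smul, neg_neg]
  have hr : ∀ (r : ℂ) (x : UniversalEnvelopingAlgebra ℂ SL2), x * algebraMap ℂ _ r = r • x :=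
    fun r x => by rw [← Algebra.commutes, Algebra.smul_def]
  have h2 : ∀ x : UniversalEnvelopingAlgebra ℂ SL2, (2 : ℂ) • x = 2 * x := fun x => by
    rw [ofNat_smul_eq_nsmul, nsmul_eq_mul]; rfl
  ext i j
  rw [Matrix.neg_apply, Matrix.mul_apply, Fin.sum_univ_three]
  simp only [lieMatrix, Matrix.map_apply, Matrix.of_apply, hr]
  fin_cases i <;> fin_cases j <;>
    simp [h01, h10, h02, h12, lie_two_zero, lie_two_one, sl2Gen, ← h2]

theorem trace_spokeMatrix_pow_add_three (m : ℕ) :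
    (spokeMatrix slForm sl2Basis ^ (m + 3)).trace =
      -4 * (spokeMatrix slForm sl2Basis ^ (m + 2)).trace +
      (2 * casimir slForm sl2Basis - 4) * (spokeMatrix slForm sl2Basis ^ (m + 1)).trace +
      2 * (2 * casimir slForm sl2Basis) * (spokeMatrix slForm sl2Basis ^ m).trace := by
  have h := Matrix.sl2_cubic sl2Gen_two_mul_zero sl2Gen_two_mul_one sl2Gen_one_mul_zero _
    two_mul_casimir_sl2Basis
  rw [← spokeMatrix_sl2Basis] at h
  rw [add_comm m 3, pow_add, h, add_mul, add_mul, Matrix.smul_mul, Matrix.smul_mul,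
    Matrix.smul_mul, one_mul, ← pow_add, ← pow_succ', Matrix.trace_add, Matrix.trace_add,
    Matrix.trace_smul, Matrix.trace_smul, Matrix.trace_smul, add_comm 2 m]
  rfl

theorem trace_spokeMatrix : (spokeMatrix slForm sl2Basis).trace = 0 := by
  simp [spokeMatrix_sl2Basis, Matrix.trace_fin_three]

theorem trace_spokeMatrix_sq :
    (spokeMatrix slForm sl2Basis ^ 2).trace = 4 * casimir slForm sl2Basis := by
  rw [show (4 : UniversalEnvelopingAlgebra ℂ SL2) = 2 * 2 by norm_num, mul_assoc,
    two_mul_casimir_sl2Basis, spokeMatrix_sl2Basis, pow_two, Matrix.trace_fin_three]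
  simp [Matrix.mul_apply, Fin.sum_univ_three]
  noncomm_ring

end

/-! ### Degrees and leading terms of the traces -/

/-- The polynomials of degree less than `n` in a fixed element `c`. -/
noncomputable def polyLT {A : Type*} [Ring A] [Algebra ℂ A] (c : A) (n : ℕ) : Submodule ℂ A :=
  (Polynomial.degreeLT ℂ n).map (Polynomial.aeval c).toLinearMap

section polyLT
variable {A : Type*} [Ring A] [Algebra ℂ A] (c : A)

theorem polyLT_mono {m n : ℕ} (h : m ≤ n) : polyLT c m ≤ polyLT c n :=
  Submodule.map_mono (Polynomial.degreeLT_mono h)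

theorem mul_mem_polyLT {x : A} {n : ℕ} (hx : x ∈ polyLT c n) : c * x ∈ polyLT c (n + 1) := by
  obtain ⟨p, hp, rfl⟩ := hx
  refine ⟨Polynomial.X * p, ?_, by simp⟩
  simp only [SetLike.mem_coe, Polynomial.mem_degreeLT] at hp ⊢
  rw [mul_comm, Polynomial.degree_mul_X, Nat.cast_succ]
  exact WithBot.add_lt_add_right (by simp) hp

theorem pow_mem_polyLT (n : ℕ) : c ^ n ∈ polyLT c (n + 1) := by
  refine ⟨Polynomial.X ^ n, ?_, by simp⟩
  simp only [SetLike.mem_coe, Polynomial.mem_degreeLT, Polynomial.degree_X_pow]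
  exact_mod_cast Nat.lt_succ_self n

theorem ofNat_mul_mem_polyLT (a : ℕ) {x : A} {n : ℕ} (hx : x ∈ polyLT c n) :
    (a : A) * x ∈ polyLT c n := by
  rw [← nsmul_eq_mul]
  exact nsmul_mem hx a

/-- The leading terms of the solution of the recursion for the traces of the powers of the matrix
of `sl_2`. -/
theorem recursion_leading_term {t : ℕ → A} (h1 : t 1 = 0) (h0 : t 0 = 3) (h2 : t 2 = 4 * c)
    (h : ∀ m, t (m + 3) = -4 * t (m + 2) + (2 * c - 4) * t (m + 1) + 2 * (2 * c) * t m) (n : ℕ) :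
    t (2 * n + 1) ∈ polyLT c (n + 1) ∧
      t (2 * n + 2) - (2 ^ (n + 2) : ℂ) • c ^ (n + 1) ∈ polyLT c (n + 1) ∧
      t (2 * n + 3) ∈ polyLT c (n + 2) := by
  have step : ∀ n, t (2 * n + 2) - (2 ^ (n + 2) : ℂ) • c ^ (n + 1) ∈ polyLT c (n + 1) →
      t (2 * n + 2) ∈ polyLT c (n + 2) := fun n hb => by
    rw [← sub_add_cancel (t (2 * n + 2)) ((2 ^ (n + 2) : ℂ) • c ^ (n + 1))]
    exact add_mem (polyLT_mono c (Nat.le_succ _) hb)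
      (Submodule.smul_mem _ _ (pow_mem_polyLT c (n + 1)))
  induction n with
  | zero =>
    have hc : c ∈ polyLT c 2 := by simpa using pow_mem_polyLT c 1
    refine ⟨by simp [h1], ?_, ?_⟩
    · have : (2 ^ (0 + 2) : ℂ) • c ^ (0 + 1) = 4 * c := by
        rw [show (2 ^ (0 + 2) : ℂ) = 4 by norm_num, ofNat_smul_eq_nsmul, nsmul_eq_mul]
        simp
      rw [this]; simp [h2]
    · have : t 3 = -((4 : ℕ) * c) := by
        rw [h 0, h1, h0, h2]
        push_cast
        noncomm_ring
      rw [mul_zero, zero_add, this]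
      exact neg_mem (ofNat_mul_mem_polyLT c 4 hc)
  | succ n ih =>
    obtain ⟨ha, hb, hd⟩ := ih
    have hb' := step n hb
    -- Only the recursion term `2 * c * t (2 * n + 2)` reaches degree `n + 2`, so the leading
    -- coefficient doubles; every other term has degree at most `n + 1`.
    have hb2 : t (2 * (n + 1) + 2) - (2 ^ (n + 1 + 2) : ℂ) • c ^ (n + 1 + 1) ∈
        polyLT c (n + 2) := by
      have : t (2 * (n + 1) + 2) - (2 ^ (n + 1 + 2) : ℂ) • c ^ (n + 1 + 1) =
          -((4 : ℕ) * t (2 * n + 3)) +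
          (2 : ℕ) * (c * (t (2 * n + 2) - (2 ^ (n + 2) : ℂ) • c ^ (n + 1))) -
          (4 : ℕ) * t (2 * n + 2) + (4 : ℕ) * (c * t (2 * n + 1)) := by
        rw [show 2 * (n + 1) + 2 = 2 * n + 1 + 3 by ring, h (2 * n + 1), mul_sub, mul_sub,
          mul_smul_comm, ← pow_succ' c, pow_succ' (2 : ℂ) (n + 2), mul_smul, ofNat_smul_eq_nsmul,
          nsmul_eq_mul, show 2 * n + 1 + 2 = 2 * n + 3 by ring]
        push_cast
        noncomm_ring
      rw [this]
      exact add_mem (sub_mem (add_mem (neg_mem (ofNat_mul_mem_polyLT c 4 hd))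
        (ofNat_mul_mem_polyLT c 2 (mul_mem_polyLT c hb))) (ofNat_mul_mem_polyLT c 4 hb'))
        (ofNat_mul_mem_polyLT c 4 (mul_mem_polyLT c ha))
    refine ⟨hd, hb2, ?_⟩
    have hb2' := step (n + 1) hb2
    have : t (2 * (n + 1) + 3) = -((4 : ℕ) * t (2 * (n + 1) + 2)) +
        (2 : ℕ) * (c * t (2 * n + 3)) - (4 : ℕ) * t (2 * n + 3) +
        (4 : ℕ) * (c * t (2 * n + 2)) := by
      rw [h (2 * (n + 1)), show 2 * (n + 1) + 1 = 2 * n + 3 by ring,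
        show 2 * (n + 1) = 2 * n + 2 by ring]
      push_cast
      noncomm_ring
    rw [this]
    exact add_mem (sub_mem (add_mem (neg_mem (ofNat_mul_mem_polyLT c 4 hb2'))
        (ofNat_mul_mem_polyLT c 2 (mul_mem_polyLT c hd)))
        (ofNat_mul_mem_polyLT c 4 (polyLT_mono c (Nat.le_succ _) hd)))
        (ofNat_mul_mem_polyLT c 4 (mul_mem_polyLT c hb'))
end polyLT
end FeynmanDiagram

/-! ### Transcendence of the Casimir element -/

namespace FeynmanDiagram
section
attribute [local instance] LieRing.ofAssociativeRing

/-- The representation of `sl_2` on polynomials (the dual of a Verma module) by the differential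
operators `E = d/dx`, `F = a x - x² d/dx`, `H = a - 2 x d/dx`. -/
noncomputable def polyRep (a : ℂ) : SL2 →ₗ⁅ℂ⁆ Module.End ℂ ℂ[X] where
  toFun x := x.1 0 1 • Polynomial.derivative +
    x.1 1 0 • (a • LinearMap.mulLeft ℂ Polynomial.X -
      LinearMap.mulLeft ℂ (Polynomial.X ^ 2) ∘ₗ Polynomial.derivative) +
    x.1 0 0 • (a • LinearMap.id -
      (2 : ℂ) • LinearMap.mulLeft ℂ Polynomial.X ∘ₗ Polynomial.derivative)
  map_add' x y := by
    have h : ∀ i j, (x + y).1 i j = x.1 i j + y.1 i j := fun _ _ => rfl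
    simp only [h]
    module
  map_smul' r x := by
    have h : ∀ i j, (r • x).1 i j = r * x.1 i j := fun _ _ => rfl
    simp only [h, RingHom.id_apply]
    module
  map_lie' {x y} := by
    have hx : Matrix.trace x.1 = 0 := x.2
    have hy : Matrix.trace y.1 = 0 := y.2
    rw [Matrix.trace_fin_two] at hx hy
    have hx' := eq_neg_of_add_eq_zero_right hx
    have hy' := eq_neg_of_add_eq_zero_right hy
    refine LinearMap.ext fun p => ?_
    simp only [LieAlgebra.SpecialLinear.sl_bracket, LieRing.of_associative_ring_bracket,
      Matrix.sub_apply, Matrix.mul_apply, Fin.sum_univ_two, hx', hy', LinearMap.sub_apply,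
      LinearMap.add_apply, LinearMap.smul_apply, Module.End.mul_apply, LinearMap.comp_apply,
      LinearMap.mulLeft_apply, LinearMap.id_apply, map_add, map_sub,
      Polynomial.derivative_mul, Polynomial.derivative_X_pow, Polynomial.derivative_X,
      Polynomial.smul_eq_C_mul, Polynomial.derivative_C, map_mul, map_neg]
    push_cast
    simp only [Polynomial.C_ofNat]
    ring

/-- The constant 1 is killed by E and has weight a, while c = 2FE + H + H²/2. -/
theorem lift_polyRep_casimir (a : ℂ) :
    UniversalEnvelopingAlgebra.lift ℂ (polyRep a) (casimir slForm sl2Basis) 1 =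
      (2⁻¹ * a ^ 2 + a) • (1 : ℂ[X]) := by
  have hE : polyRep a (sl2Basis 0) = Polynomial.derivative := by
    simp [polyRep, sl2Basis_zero]
  have hF : polyRep a (sl2Basis 1) = a • LinearMap.mulLeft ℂ Polynomial.X -
      LinearMap.mulLeft ℂ (Polynomial.X ^ 2) ∘ₗ Polynomial.derivative := by
    simp [polyRep, sl2Basis_one]
  have hH : polyRep a (sl2Basis 2) = a • LinearMap.id -
      (2 : ℂ) • LinearMap.mulLeft ℂ Polynomial.X ∘ₗ Polynomial.derivative := by
    simp [polyRep, sl2Basis_two]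
  rw [casimir_sl2Basis]
  simp only [sl2Gen, map_add, map_mul, map_smul, UniversalEnvelopingAlgebra.lift_ι_apply, hE, hF,
    hH]
  simp [smul_smul]
  module

/-- If p(c) = 0, then p vanishes at every eigenvalue of c. Since a²/2 + a takes every complex value,
p = 0. -/
theorem transcendental_casimir_sl2Basis : Transcendental ℂ (casimir slForm sl2Basis) := by
  rw [transcendental_iff]
  intro p hp
  refine Polynomial.funext fun μ => ?_
  -- Completing the square, a²/2 + a = μ becomes (a + 1)² = 1 + 2μ; here `z` is a + 1.
  obtain ⟨z, hz⟩ := IsAlgClosed.exists_pow_nat_eq (1 + 2 * μ) (n := 2) two_pos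
  have ha : 2⁻¹ * (z - 1) ^ 2 + (z - 1) = μ := by
    linear_combination hz / 2
  have hc := lift_polyRep_casimir (z - 1)
  rw [ha] at hc
  have hev := Module.End.aeval_apply_of_hasEigenvector (p := p)
    ⟨Module.End.mem_eigenspace_iff.2 hc, one_ne_zero⟩
  rw [Polynomial.aeval_algHom_apply, hp, map_zero, LinearMap.zero_apply] at hev
  simpa using (smul_eq_zero.1 hev.symm).resolve_right one_ne_zero

end
end FeynmanDiagram

/-! ### Conclusion -/

/-- `w_{2n}` is evaluated in any basis `e` of `sl_2` and with the Wilson line cut at any place `s`.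
Transcendence of the Casimir `c` says that `ℂ[c]` is a polynomial ring, so that the leading term in
`c` is meaningful. -/
theorem proposition5p3 {ι : Type*} [Fintype ι] [DecidableEq ι]
    (e : Module.Basis ι ℂ FeynmanDiagram.SL2) (n : ℕ) (hn : 2 ≤ n) (s : ℕ) :
    Transcendental ℂ (FeynmanDiagram.casimir FeynmanDiagram.slForm e) ∧
    ∃ q : ℂ[X], q.degree < (n : WithBot ℕ) ∧
      FeynmanDiagram.universalWeight FeynmanDiagram.slForm e (FeynmanDiagram.wheel (2 * n)) s =
        (2 : ℂ) ^ (n + 1) • FeynmanDiagram.casimir FeynmanDiagram.slForm e ^ n +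
          Polynomial.aeval (FeynmanDiagram.casimir FeynmanDiagram.slForm e) q := by
  open FeynmanDiagram in
  rw [casimir_basis_change slForm_nondegenerate e sl2Basis]
  refine ⟨transcendental_casimir_sl2Basis, ?_⟩
  obtain ⟨m, rfl⟩ : ∃ m, n = m + 1 := ⟨n - 1, by omega⟩
  obtain ⟨q, hq, hqt⟩ := (recursion_leading_term (casimir slForm sl2Basis)
    (t := fun m => (spokeMatrix slForm sl2Basis ^ m).trace)
    (by simpa using trace_spokeMatrix) (by simp) trace_spokeMatrix_sq
    trace_spokeMatrix_pow_add_three m).2.1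
  refine ⟨q, Polynomial.mem_degreeLT.1 hq, ?_⟩
  rw [show 2 * (m + 1) = 2 * m + 1 + 1 by ring, universalWeight_wheel,
    trace_spokeMatrix_pow_basis_change slForm_nondegenerate slForm_lie e sl2Basis]
  exact (sub_eq_iff_eq_add'.1 hqt.symm)
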